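/- Rings are associative but need not have an identity, and all ring topologies are Hausdorff. A topological ring $R$ is called left linearly compact if it has a base of neighbourhoods of $0$ consisting of left ideals and every family of cosets of closed left ideals of $R$ with the finite intersection property has a nonempty intersection; it is called semisimple if its Jacobson radical is zero; and it is called minimal if there is no Hausdorff ring topology on $R$ that is strictly coarser than the given one. For a division ring $\Delta$ and $n\ge 1$ let $M(n,\Delta)$ be the ring of $n\times n$ matrices over $\Delta$. Let $R$ be a left linearly compact semisimple topological ring. Then $R$ is minimal if and only if $R$ has no direct summand (that is, there is no decomposition $R=I\oplus J$ into two-sided ideals with $I$) isomorphic as a ring to $M(n,\Delta)$ for some $n\ge 1$ and some division ring $\Delta$ which admits a nondiscrete Hausdorff ring topology. -/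

import Mathlib

universe u

/-- A left ideal of a ring that need not have an identity: an additive subgroup that is stable
under left multiplication by all ring elements. -/
def IsLeftIdeal {R : Type*} [NonUnitalRing R] (I : AddSubgroup R) : Prop :=
  ∀ r x : R, x ∈ I → r * x ∈ I

/-- A modular (also called regular) maximal left ideal: a proper left ideal `M` that is maximal
among the proper left ideals and for which there is `e` with `x - x * e ∈ M` for all `x`.
In a ring with identity every left ideal is modular. -/
structure IsModularMaximalLeftIdeal {R : Type*} [NonUnitalRing R] (M : AddSubgroup R) : Prop where
  isLeftIdeal : IsLeftIdeal M
  modular : ∃ e : R, ∀ x : R, x - x * e ∈ M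
  ne_top : M ≠ ⊤
  maximal : ∀ I : AddSubgroup R, IsLeftIdeal I → M < I → I = ⊤

/-- Membership in the Jacobson radical of a ring that need not have an identity: the intersection
of all modular maximal left ideals (the whole ring if there are none). -/
def InJacobsonRadical {R : Type*} [NonUnitalRing R] (x : R) : Prop :=
  ∀ M : AddSubgroup R, IsModularMaximalLeftIdeal M → x ∈ M

/-- A ring is semisimple (in the sense of Jacobson) if its Jacobson radical is zero. -/
def IsJacobsonSemisimple (R : Type*) [NonUnitalRing R] : Prop :=
  ∀ x : R, InJacobsonRadical x → x = 0

/-- `C` is a coset of a closed left ideal. -/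
def IsClosedLeftCoset {R : Type*} [NonUnitalRing R] [TopologicalSpace R] (C : Set R) : Prop :=
  ∃ (I : AddSubgroup R) (a : R), IsLeftIdeal I ∧ IsClosed (I : Set R) ∧ C = {x | x - a ∈ I}

/-- A Hausdorff topological ring is left linearly compact if the neighbourhoods of zero have a base
consisting of left ideals and every family of cosets of closed left ideals with the finite
intersection property has nonempty intersection. -/
structure IsLeftLinearlyCompact (R : Type*) [NonUnitalRing R] [TopologicalSpace R] : Prop where
  isTopologicalRing : IsTopologicalRing R
  t2Space : T2Space R
  linear : ∀ U ∈ nhds (0 : R), ∃ I : AddSubgroup R,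
    IsLeftIdeal I ∧ (I : Set R) ∈ nhds (0 : R) ∧ (I : Set R) ⊆ U
  compact : ∀ 𝒞 : Set (Set R), (∀ C ∈ 𝒞, IsClosedLeftCoset C) →
    (∀ F : Set (Set R), F ⊆ 𝒞 → F.Finite → (⋂₀ F).Nonempty) → (⋂₀ 𝒞).Nonempty

/-- A Hausdorff topological ring is minimal if no Hausdorff ring topology on it is strictly coarser
than the given one. (`t ≤ u` says that `u` is coarser than `t`.) -/
def IsMinimalTopologicalRing (R : Type*) [NonUnitalRing R] [t : TopologicalSpace R] : Prop :=
  ∀ u : TopologicalSpace R, @IsTopologicalRing R u _ → @T2Space R u → t ≤ u → u = t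

/-- The ring admits a nondiscrete Hausdorff ring topology. -/
def AdmitsNondiscreteHausdorffRingTopology (Δ : Type*) [NonUnitalRing Δ] : Prop :=
  ∃ u : TopologicalSpace Δ, @IsTopologicalRing Δ u _ ∧ @T2Space Δ u ∧ ¬ @DiscreteTopology Δ u

/-- `R` is the direct sum of two of its two-sided ideals, the first of which is, as a ring,
isomorphic to `S`. -/
def HasDirectSummand (R S : Type*) [NonUnitalRing R] [NonUnitalRing S] : Prop :=
  ∃ I J : TwoSidedIdeal R, IsCompl I J ∧ Nonempty (I ≃+* S)

/-! In a linearly compact semisimple ring the open modular maximal left ideals intersect in zero.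
This yields an identity (`exists_one`) and a complement for every closed left ideal
(`exists_isCompl`). So the open left ideals form an `IsSemisimpleFamily`, and R/U is semisimple of
finite length for each open U.

Given a coarser Hausdorff ring topology, it suffices to show that every originally open maximal left
ideal M is open in it. Write R = L ⊕ M with L minimal, and let P be the annihilator of L. If P is
not open originally, a chain condition argument makes L discrete in the coarser topology, so M is
open (`isOpen_of_annihilator_notMem`). If P is open originally, R/P is simple artinian and splits
off as a matrix ring over some Δ; since Δ has only the discrete ring topology, P and hence M is open
in the coarser topology (`isOpen_of_matrix_summand`).

Conversely, the complement of a summand M(n, Δ) is open because matrix rings are artinian. The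
summand is thus discrete, and a nondiscrete topology on Δ makes the topology of R strictly coarser.
-/

open Topology

/-! ### Jacobson radical, linear compactness, existence of an identity -/

section NonUnital

variable {R : Type*} [NonUnitalRing R]

theorem IsLeftIdeal.inf {I J : AddSubgroup R} (hI : IsLeftIdeal I) (hJ : IsLeftIdeal J) :
    IsLeftIdeal (I ⊓ J) :=
  fun r x hx => ⟨hI r x hx.1, hJ r x hx.2⟩

theorem IsLeftIdeal.sup {I J : AddSubgroup R} (hI : IsLeftIdeal I) (hJ : IsLeftIdeal J) :
    IsLeftIdeal (I ⊔ J) := by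
  intro r x hx
  obtain ⟨a, ha, b, hb, rfl⟩ := AddSubgroup.mem_sup.1 hx
  rw [mul_add]
  exact AddSubgroup.mem_sup.2 ⟨_, hI r a ha, _, hJ r b hb, rfl⟩

theorem IsLeftIdeal.iInf {ι : Sort*} {I : ι → AddSubgroup R} (hI : ∀ i, IsLeftIdeal (I i)) :
    IsLeftIdeal (⨅ i, I i) := by
  intro r x hx
  rw [AddSubgroup.mem_iInf] at hx ⊢
  exact fun i => hI i r x (hx i)

/-- The left ideal of all `r - r * x`. -/
def mulOneSub (x : R) : AddSubgroup R :=
  (AddMonoidHom.id R - AddMonoidHom.mulRight x).range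

theorem mem_mulOneSub {x y : R} : y ∈ mulOneSub x ↔ ∃ r, r - r * x = y := by
  simp [mulOneSub, AddMonoidHom.mem_range]

theorem isLeftIdeal_mulOneSub (x : R) : IsLeftIdeal (mulOneSub x) := by
  intro s y hy
  obtain ⟨r, rfl⟩ := mem_mulOneSub.1 hy
  exact mem_mulOneSub.2 ⟨s * r, by rw [mul_sub, mul_assoc]⟩

/-- A left ideal containing all `r - r * x` but not `x` is contained in a modular maximal one. -/
theorem exists_isModularMaximalLeftIdeal {x : R} {I : AddSubgroup R} (hI : IsLeftIdeal I)
    (hle : mulOneSub x ≤ I) (hx : x ∉ I) :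
    ∃ M : AddSubgroup R, IsModularMaximalLeftIdeal M ∧ I ≤ M ∧ x ∉ M := by
  obtain ⟨M, hIM, hM⟩ := zorn_le_nonempty₀ {K : AddSubgroup R | IsLeftIdeal K ∧ x ∉ K}
    (by
      intro c hc hchain K hK
      have hmem : ∀ {y}, y ∈ sSup c ↔ ∃ s ∈ c, y ∈ s := fun {y} =>
        AddSubgroup.mem_sSup_of_directedOn ⟨K, hK⟩ hchain.directedOn
      refine ⟨sSup c, ⟨?_, ?_⟩, fun z hz => le_sSup hz⟩
      · intro r y hy
        obtain ⟨s, hs, hys⟩ := hmem.1 hy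
        exact hmem.2 ⟨s, hs, (hc hs).1 r y hys⟩
      · intro hxs
        obtain ⟨s, hs, hys⟩ := hmem.1 hxs
        exact (hc hs).2 hys) I ⟨hI, hx⟩
  have hsub : ∀ r, r - r * x ∈ M := fun r => hIM (hle (mem_mulOneSub.2 ⟨r, rfl⟩))
  refine ⟨M, ⟨hM.prop.1, ⟨x, hsub⟩, fun h => hM.prop.2 (h ▸ AddSubgroup.mem_top x), ?_⟩, hIM,
    hM.prop.2⟩
  intro K hK hMK
  have hxK : x ∈ K := by
    by_contra hxK
    exact hMK.not_ge (hM.le_of_ge ⟨hK, hxK⟩ hMK.le)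
  refine eq_top_iff.2 fun r _ => ?_
  have := K.add_mem (hMK.le (hsub r)) (hK r x hxK)
  simpa using this

/-- A left ideal all of whose elements are left quasi-regular lies in the Jacobson radical. -/
theorem IsLeftIdeal.le_of_quasiregular {J M : AddSubgroup R} (hJ : IsLeftIdeal J)
    (hq : ∀ j ∈ J, j ∈ mulOneSub j) (hM : IsModularMaximalLeftIdeal M) : J ≤ M := by
  by_contra hJM
  have htop := hM.maximal (M ⊔ J) (hM.isLeftIdeal.sup hJ) (left_lt_sup.2 hJM)
  obtain ⟨e, he⟩ := hM.modular
  obtain ⟨m, hm, j, hj, hmj⟩ := AddSubgroup.mem_sup.1 (htop ▸ AddSubgroup.mem_top e)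
  -- Since e = m + j, r - r j = (r - r e) + r m: modulo M, j is a right identity as well.
  have hmem : ∀ r, r - r * j ∈ M := by
    intro r
    have h := M.add_mem (he r) (hM.isLeftIdeal r m hm)
    rw [← hmj] at h
    convert h using 1
    noncomm_ring
  have hjM : j ∈ M := by
    obtain ⟨r, hr⟩ := mem_mulOneSub.1 (hq j hj)
    rw [← hr]
    exact hmem r
  refine hM.ne_top (eq_top_iff.2 fun r _ => ?_)
  simpa using M.add_mem (hmem r) (hM.isLeftIdeal r j hjM)

/-- The simple module `R / M` has no nonzero element killed by `R`. -/
theorem IsModularMaximalLeftIdeal.mem_of_forall_mul_mem {M : AddSubgroup R}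
    (hM : IsModularMaximalLeftIdeal M) {d : R} (hd : ∀ x, x * d ∈ M) : d ∈ M := by
  obtain ⟨e, he⟩ := hM.modular
  let T : AddSubgroup R :=
    { carrier := {y | ∀ x, x * y ∈ M}
      add_mem' := fun {a b} ha hb x => by rw [mul_add]; exact M.add_mem (ha x) (hb x)
      zero_mem' := fun x => by rw [mul_zero]; exact M.zero_mem
      neg_mem' := fun {a} ha x => by rw [mul_neg]; exact M.neg_mem (ha x) }
  have hT : IsLeftIdeal T := fun r y hy x => by rw [← mul_assoc]; exact hy _
  have hMT : M ≤ T := fun y hy x => hM.isLeftIdeal x y hy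
  by_contra hdM
  have hlt : M < T := lt_of_le_of_ne hMT fun h => hdM (h.ge hd)
  have heT : e ∈ T := hM.maximal T hT hlt ▸ AddSubgroup.mem_top e
  refine hM.ne_top (eq_top_iff.2 fun r _ => ?_)
  simpa using M.add_mem (he r) (heT r)

variable [TopologicalSpace R]

/-- Linear compactness for indexed families of cosets. -/
theorem IsLeftLinearlyCompact.exists_forall_sub_mem (hlc : IsLeftLinearlyCompact R) {ι : Type*}
    (I : ι → AddSubgroup R) (a : ι → R) (hI : ∀ i, IsLeftIdeal (I i))
    (hcl : ∀ i, IsClosed (I i : Set R)) (hfin : ∀ s : Finset ι, ∃ x, ∀ i ∈ s, x - a i ∈ I i) :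
    ∃ x, ∀ i, x - a i ∈ I i := by
  classical
  obtain ⟨x, hx⟩ := hlc.compact (Set.range fun i => {x | x - a i ∈ I i})
    (by rintro _ ⟨i, rfl⟩; exact ⟨I i, a i, hI i, hcl i, rfl⟩)
    (by
      intro F hF hFfin
      have := hFfin.fintype
      choose i hi using fun C : F => hF C.2
      obtain ⟨x, hx⟩ := hfin (Finset.univ.image i)
      refine ⟨x, fun C hC => ?_⟩
      have h := hx (i ⟨C, hC⟩) (Finset.mem_image_of_mem i (Finset.mem_univ _))
      have hC' : {x | x - a (i ⟨C, hC⟩) ∈ I (i ⟨C, hC⟩)} = C := hi ⟨C, hC⟩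
      exact hC' ▸ h)
  exact ⟨x, fun i => hx _ ⟨i, rfl⟩⟩

theorem IsLeftLinearlyCompact.exists_notMem (hlc : IsLeftLinearlyCompact R) {x : R} (hx : x ≠ 0) :
    ∃ I : AddSubgroup R, IsLeftIdeal I ∧ IsOpen (I : Set R) ∧ x ∉ I := by
  have := hlc.isTopologicalRing
  have := hlc.t2Space
  obtain ⟨I, hI, hI0, hIx⟩ := hlc.linear {x}ᶜ (isOpen_compl_singleton.mem_nhds hx.symm)
  exact ⟨I, hI, I.isOpen_of_mem_nhds hI0, fun h => hIx h rfl⟩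

/-- Linear compactness makes the image of r ↦ r - r x closed: solving the equation modulo every open
U amounts to meeting cosets of closed left ideals, and these have a common point. -/
theorem IsLeftLinearlyCompact.mem_mulOneSub (hlc : IsLeftLinearlyCompact R) {x y : R}
    (h : ∀ U : AddSubgroup R, IsLeftIdeal U → IsOpen (U : Set R) → y ∈ mulOneSub x ⊔ U) :
    y ∈ mulOneSub x := by
  have := hlc.isTopologicalRing
  let φ : R →+ R := AddMonoidHom.id R - AddMonoidHom.mulRight x
  have hφ : ∀ r, φ r = r - r * x := fun r => by simp [φ]
  have hφc : Continuous φ := by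
    have : (φ : R → R) = fun r => r - r * x := funext hφ
    rw [this]; fun_prop
  let ι := {U : AddSubgroup R // IsLeftIdeal U ∧ IsOpen (U : Set R)}
  have key : ∀ U : ι, ∃ r, φ r - y ∈ U.1 := by
    rintro ⟨U, hU, hUo⟩
    obtain ⟨n, hn, w, hw, hy⟩ := AddSubgroup.mem_sup.1 (h U hU hUo)
    obtain ⟨r, hr⟩ := _root_.mem_mulOneSub.1 hn
    refine ⟨r, ?_⟩
    rw [hφ, hr, ← hy]
    simpa using hw
  choose a ha using key
  obtain ⟨r, hr⟩ := hlc.exists_forall_sub_mem (ι := ι) (fun U => U.1.comap φ) a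
    (by
      rintro ⟨U, hU, hUo⟩ s r hr
      rw [AddSubgroup.mem_comap, hφ] at hr ⊢
      rw [mul_assoc, ← mul_sub]
      exact hU s _ hr)
    (fun U => ((U.1.isClosed_of_isOpen U.2.2).preimage hφc))
    (by
      intro s
      let V : ι := ⟨⨅ U : s, U.1.1, IsLeftIdeal.iInf fun U => U.1.2.1, by
        have : ((⨅ U : s, U.1.1 : AddSubgroup R) : Set R) = ⋂ U : s, (U.1.1 : Set R) := by
          simp
        rw [this]
        exact isOpen_iInter_of_finite fun U => U.1.2.2⟩
      refine ⟨a V, fun U hU => ?_⟩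
      have hV : V.1 ≤ U.1 := iInf_le (fun U : s => U.1.1) ⟨U, hU⟩
      rw [AddSubgroup.mem_comap, map_sub]
      simpa using U.1.sub_mem (hV (ha V)) (ha U))
  refine _root_.mem_mulOneSub.2 ⟨r, ?_⟩
  rw [← hφ, ← sub_eq_zero]
  by_contra hne
  obtain ⟨U, hU, hUo, hnot⟩ := hlc.exists_notMem hne
  have h1 := hr ⟨U, hU, hUo⟩
  rw [AddSubgroup.mem_comap, map_sub] at h1
  exact hnot (by simpa using U.add_mem h1 (ha ⟨U, hU, hUo⟩))

/-- In a linearly compact semisimple ring the open modular maximal left ideals separate points. -/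
theorem IsLeftLinearlyCompact.eq_zero_of_forall_mem (hlc : IsLeftLinearlyCompact R)
    (hss : IsJacobsonSemisimple R) {x : R}
    (hx : ∀ M : AddSubgroup R, IsModularMaximalLeftIdeal M → IsOpen (M : Set R) → x ∈ M) :
    x = 0 := by
  have := hlc.isTopologicalRing
  let J : AddSubgroup R :=
    ⨅ M : {M : AddSubgroup R // IsModularMaximalLeftIdeal M ∧ IsOpen (M : Set R)}, M.1
  have hJ : IsLeftIdeal J := IsLeftIdeal.iInf fun M => M.2.1.isLeftIdeal
  have hmem : ∀ {y}, y ∈ J ↔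
      ∀ M : AddSubgroup R, IsModularMaximalLeftIdeal M → IsOpen (M : Set R) → y ∈ M := by
    intro y
    simp only [J, AddSubgroup.mem_iInf, Subtype.forall, and_imp]
  refine hss x fun M hM => hJ.le_of_quasiregular ?_ hM (hmem.2 hx)
  intro j hj
  refine hlc.mem_mulOneSub fun U hU hUo => ?_
  by_contra hnot
  obtain ⟨N, hN, hle, hjN⟩ :=
    exists_isModularMaximalLeftIdeal ((isLeftIdeal_mulOneSub j).sup hU) le_sup_left hnot
  exact hjN (hmem.1 hj N hN (AddSubgroup.isOpen_mono (le_sup_right.trans hle) hUo))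

/-- A linearly compact semisimple ring has an identity. -/
theorem IsLeftLinearlyCompact.exists_one (hlc : IsLeftLinearlyCompact R)
    (hss : IsJacobsonSemisimple R) : ∃ e : R, ∀ x : R, e * x = x ∧ x * e = x := by
  classical
  have := hlc.isTopologicalRing
  let ι := {M : AddSubgroup R // IsModularMaximalLeftIdeal M ∧ IsOpen (M : Set R)}
  choose a ha using fun M : ι => M.2.1.modular
  obtain ⟨e, he⟩ := hlc.exists_forall_sub_mem (ι := ι) (fun M => M.1) a
    (fun M => M.2.1.isLeftIdeal) (fun M => M.1.isClosed_of_isOpen M.2.2) (by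
      intro s
      induction s using Finset.induction_on with
      | empty => exact ⟨0, by simp⟩
      | insert M s hMs ih =>
        obtain ⟨b, hb⟩ := ih
        let K : AddSubgroup R := ⨅ N : s, N.1.1
        have hK : IsLeftIdeal K := IsLeftIdeal.iInf fun N => N.1.2.1.isLeftIdeal
        have hKle : ∀ N ∈ s, K ≤ N.1 := fun N hN => iInf_le (fun N : s => N.1.1) ⟨N, hN⟩
        have hmod : ∀ x, x - x * b ∈ K := by
          intro x
          rw [AddSubgroup.mem_iInf]
          rintro ⟨N, hN⟩
          have h := N.1.sub_mem (ha N x) (N.2.1.isLeftIdeal x _ (hb N hN))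
          convert h using 1
          noncomm_ring
        -- If K ≤ M, then b is already a right identity modulo M. Otherwise M + K = R, and b is
        -- corrected by an element of K, as in the Chinese remainder theorem.
        by_cases hKM : K ≤ M.1
        · refine ⟨b, fun N hN => ?_⟩
          rcases Finset.mem_insert.1 hN with rfl | hN
          · refine N.2.1.mem_of_forall_mul_mem fun x => ?_
            have h := N.1.sub_mem (ha N x) (hKM (hmod x))
            convert h using 1
            noncomm_ring
          · exact hb N hN
        · have htop := M.2.1.maximal (M.1 ⊔ K) (M.2.1.isLeftIdeal.sup hK) (left_lt_sup.2 hKM)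
          obtain ⟨m, hm, k, hk, hmk⟩ :=
            AddSubgroup.mem_sup.1 (htop ▸ AddSubgroup.mem_top (a M - b))
          refine ⟨b + k, fun N hN => ?_⟩
          rcases Finset.mem_insert.1 hN with rfl | hN
          · have h := N.1.neg_mem hm
            convert h using 1
            rw [eq_sub_of_add_eq hmk]
            abel
          · have h := N.1.add_mem (hb N hN) (hKle N hN hk)
            convert h using 1
            abel)
  have hright : ∀ x, x * e = x := by
    intro x
    rw [eq_comm, ← sub_eq_zero]
    refine hlc.eq_zero_of_forall_mem hss fun M hM hMo => ?_
    have h := M.sub_mem (ha ⟨M, hM, hMo⟩ x) (hM.isLeftIdeal x _ (he ⟨M, hM, hMo⟩))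
    convert h using 1
    noncomm_ring
  refine ⟨e, fun x => ⟨?_, hright x⟩⟩
  rw [← sub_eq_zero]
  refine hlc.eq_zero_of_forall_mem hss fun M hM hMo => hM.mem_of_forall_mul_mem fun y => ?_
  rw [mul_sub, ← mul_assoc, hright, sub_self]
  exact M.zero_mem

end NonUnital

/-! ### Complements of closed left ideals -/

section Unital

variable {R : Type*} [Ring R] [TopologicalSpace R]

/-- In a linearly compact semisimple ring every closed left ideal is a direct summand. -/
theorem IsLeftLinearlyCompact.exists_isCompl (hlc : IsLeftLinearlyCompact R)
    (hss : IsJacobsonSemisimple R) {C : Ideal R} (hC : IsClosed (C : Set R)) :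
    ∃ L : Ideal R, IsCompl L C := by
  classical
  have := hlc.isTopologicalRing
  have hleft : ∀ I : Ideal R, IsLeftIdeal I.toAddSubgroup := fun I r x hx => I.mul_mem_left r hx
  obtain ⟨L, -, hL⟩ := zorn_le_nonempty₀ (α := (Ideal R)ᵒᵈ)
    {K | IsClosed ((OrderDual.ofDual K : Ideal R) : Set R) ∧ OrderDual.ofDual K ⊔ C = ⊤}
    (by
      intro c hc hchain K₀ hK₀
      have hc' : ∀ K : c, IsClosed ((OrderDual.ofDual K.1 : Ideal R) : Set R) ∧
        OrderDual.ofDual K.1 ⊔ C = ⊤ := fun K => hc K.2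
      refine ⟨OrderDual.toDual (⨅ K : c, OrderDual.ofDual K.1), ⟨?_, ?_⟩, ?_⟩
      · rw [OrderDual.ofDual_toDual, Submodule.coe_iInf]
        exact isClosed_iInter fun K => (hc' K).1
      -- The index `none` stands for the coset 1 + C, `some K` for K itself; a common point x lies
      -- in every K and differs from 1 by an element of C.
      · obtain ⟨x, hx⟩ := hlc.exists_forall_sub_mem (ι := Option c)
          (fun i => i.elim C.toAddSubgroup fun K => (OrderDual.ofDual K.1).toAddSubgroup)
          (fun i => i.elim 1 fun _ => 0)
          (by rintro (_ | K) <;> exact hleft _)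
          (by rintro (_ | K); exacts [hC, (hc' K).1])
          (by
            intro s
            have hmin : ∃ K ∈ c, ∀ i ∈ s, ∀ K' : c, i = some K' →
                (OrderDual.ofDual K : Ideal R) ≤ OrderDual.ofDual K'.1 := by
              induction s using Finset.induction_on with
              | empty => exact ⟨K₀, hK₀, by simp⟩
              | insert i s his ih =>
                obtain ⟨K, hK, hKs⟩ := ih
                rcases i with _ | K'
                · refine ⟨K, hK, fun i hi K' hK' => ?_⟩
                  rcases Finset.mem_insert.1 hi with rfl | hi
                  · simp at hK'
                  · exact hKs i hi K' hK'
                · rcases hchain.total hK K'.2 with h | h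
                  · refine ⟨K', K'.2, fun i hi K'' hK'' => ?_⟩
                    rcases Finset.mem_insert.1 hi with rfl | hi
                    · simp only [Option.some.injEq] at hK''
                      rw [hK'']
                    · exact le_trans h (hKs i hi K'' hK'')
                  · refine ⟨K, hK, fun i hi K'' hK'' => ?_⟩
                    rcases Finset.mem_insert.1 hi with rfl | hi
                    · simp only [Option.some.injEq] at hK''
                      rw [← hK'']
                      exact h
                    · exact hKs i hi K'' hK''
            obtain ⟨K, hK, hKs⟩ := hmin
            obtain ⟨k, hk, d, hd, hkd⟩ := Submodule.mem_sup.1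
              ((hc hK).2 ▸ (Submodule.mem_top : (1 : R) ∈ (⊤ : Ideal R)))
            refine ⟨k, ?_⟩
            rintro (_ | K') hi
            · change k - 1 ∈ C
              rw [← hkd, sub_add_cancel_left]
              exact C.neg_mem hd
            · change k - 0 ∈ OrderDual.ofDual K'.1
              rw [sub_zero]
              exact hKs _ hi K' rfl hk)
        have hx1 : x - 1 ∈ C := hx none
        have hxK : ∀ K : c, x ∈ OrderDual.ofDual K.1 := fun K => by
          have h : x - 0 ∈ OrderDual.ofDual K.1 := hx (some K)
          rwa [sub_zero] at h
        rw [OrderDual.ofDual_toDual, Ideal.eq_top_iff_one]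
        refine Submodule.mem_sup.2 ⟨x, (Submodule.mem_iInf _).2 hxK, -(x - 1), C.neg_mem hx1, ?_⟩
        abel
      · intro K hK
        exact iInf_le (fun K : c => (OrderDual.ofDual K.1 : Ideal R)) ⟨K, hK⟩)
    (OrderDual.toDual ⊤) ⟨isClosed_univ, top_sup_eq _⟩
  obtain ⟨⟨hLcl, hLC⟩, hmin⟩ := hL
  refine ⟨OrderDual.ofDual L, disjoint_iff.2 ?_, codisjoint_iff.2 hLC⟩
  set L' : Ideal R := OrderDual.ofDual L with hL'
  refine (Submodule.eq_bot_iff _).2 fun x hx => hlc.eq_zero_of_forall_mem hss fun M hM hMo => ?_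
  by_contra hxM
  let M' : Ideal R := { M with smul_mem' := fun r x hx => hM.isLeftIdeal r x hx }
  have hMmax : ∀ y, ∃ r, y - r * x ∈ M' := by
    intro y
    have htop := hM.maximal (M' ⊔ Ideal.span {x}).toAddSubgroup (hleft _) (by
      refine lt_of_le_of_ne (fun z hz => Submodule.mem_sup_left (S := M') hz) fun h => hxM ?_
      rw [h]
      exact Submodule.mem_sup_right (S := M') (Ideal.mem_span_singleton_self x))
    have hy : y ∈ M' ⊔ Ideal.span {x} := by
      have : y ∈ (M' ⊔ Ideal.span {x}).toAddSubgroup := htop ▸ AddSubgroup.mem_top y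
      exact this
    obtain ⟨m, hm, z, hz, rfl⟩ := Submodule.mem_sup.1 hy
    obtain ⟨r, rfl⟩ := Ideal.mem_span_singleton'.1 hz
    exact ⟨r, by simpa using hm⟩
  -- Elements of L move into M by subtracting multiples of x, which lie in C; so L ∩ M would be a
  -- smaller closed supplement.
  have hmem : (L' ⊓ M') ⊔ C = ⊤ := by
    rw [eq_top_iff, ← hLC, sup_le_iff]
    refine ⟨fun y hy => ?_, le_sup_right⟩
    obtain ⟨r, hr⟩ := hMmax y
    exact Submodule.mem_sup.2 ⟨y - r * x,
      ⟨L'.sub_mem hy (L'.mul_mem_left r hx.1), hr⟩, r * x, C.mul_mem_left r hx.2, by abel⟩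
  have hle : L' ≤ L' ⊓ M' := hmin (y := OrderDual.toDual (L' ⊓ M'))
    ⟨hLcl.inter (M.isClosed_of_isOpen hMo), hmem⟩ (inf_le_left : L' ⊓ M' ≤ L')
  exact hxM (hle hx.1).2

end Unital

/-! ### Algebra of semisimple families of left ideals -/

section SemisimpleFilter

variable {R : Type*} [Ring R]

/-- An upward closed separating family of left ideals that are direct summands. -/
structure IsSemisimpleFamily (𝒪 : Set (Ideal R)) : Prop where
  mono : ∀ {U V : Ideal R}, U ∈ 𝒪 → U ≤ V → V ∈ 𝒪
  exists_isCompl : ∀ {U : Ideal R}, U ∈ 𝒪 → ∃ L, IsCompl L U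
  exists_notMem : ∀ {x : R}, x ≠ 0 → ∃ U ∈ 𝒪, x ∉ U

/-- The element e is the L-component of 1; right multiplication by it projects onto L along C. -/
theorem IsCompl.exists_idempotent {L C : Ideal R} (h : IsCompl L C) :
    ∃ e ∈ L, (∀ x ∈ L, x * e = x) ∧ ∀ x, x ∈ C ↔ x * e = 0 := by
  obtain ⟨e, he, c, hc, hec⟩ := Submodule.mem_sup.1
    (h.sup_eq_top ▸ (Submodule.mem_top : (1 : R) ∈ (⊤ : Ideal R)))
  have hdisj : ∀ x ∈ L, x ∈ C → x = 0 := fun x hL hC =>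
    (Submodule.eq_bot_iff _).1 h.inf_eq_bot x ⟨hL, hC⟩
  have hsum : ∀ x, x * e + x * c = x := fun x => by rw [← mul_add, hec, mul_one]
  refine ⟨e, he, fun x hx => ?_, fun x => ⟨fun hx => ?_, fun hx => ?_⟩⟩
  · have h0 : x * c = 0 := hdisj _ (by
      rw [eq_sub_of_add_eq' (hsum x)]
      exact L.sub_mem hx (L.mul_mem_left x he)) (C.mul_mem_left x hc)
    simpa [h0] using hsum x
  · refine hdisj _ (L.mul_mem_left x he) ?_
    rw [eq_sub_of_add_eq (hsum x)]
    exact C.sub_mem hx (C.mul_mem_left x hc)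
  · rw [← hsum x, hx, zero_add]
    exact C.mul_mem_left x hc

namespace IsSemisimpleFamily

variable {𝒪 : Set (Ideal R)} (h𝒪 : IsSemisimpleFamily 𝒪)
include h𝒪

theorem isSemisimpleModule_quotient {U : Ideal R} (hU : U ∈ 𝒪) : IsSemisimpleModule R (R ⧸ U) := by
  rw [isSemisimpleModule_iff]
  refine ⟨fun N => ?_⟩
  have hle : U ≤ N.comap U.mkQ := Submodule.le_comap_mkQ U N
  obtain ⟨L, hL⟩ := h𝒪.exists_isCompl (h𝒪.mono hU hle)
  refine ⟨Submodule.map U.mkQ L, ?_, ?_⟩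
  · rw [disjoint_iff, Submodule.eq_bot_iff]
    rintro _ ⟨hN, x, hx, rfl⟩
    have : x = 0 := (Submodule.eq_bot_iff _).1 hL.inf_eq_bot x ⟨hx, hN⟩
    rw [this, map_zero]
  · rw [codisjoint_iff, eq_top_iff]
    intro y _
    obtain ⟨x, rfl⟩ := U.mkQ_surjective y
    obtain ⟨l, hl, n, hn, rfl⟩ := Submodule.mem_sup.1
      (hL.sup_eq_top ▸ (Submodule.mem_top : x ∈ (⊤ : Ideal R)))
    rw [map_add, add_comm]
    exact Submodule.add_mem_sup hn ⟨l, hl, rfl⟩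

theorem exists_isCoatom {U : Ideal R} (hU : U ∈ 𝒪) {x : R} (hx : x ∉ U) :
    ∃ M : Ideal R, IsCoatom M ∧ U ≤ M ∧ x ∉ M := by
  have := h𝒪.isSemisimpleModule_quotient hU
  have hne : U.mkQ x ∉ Module.jacobson R (R ⧸ U) := by
    rw [IsSemisimpleModule.jacobson_eq_bot, Submodule.mem_bot]
    simpa using hx
  simp only [Module.jacobson, Submodule.mem_sInf, not_forall] at hne
  obtain ⟨N, hN, hxN⟩ := hne
  refine ⟨N.comap U.mkQ, ?_, ?_, hxN⟩
  · exact Submodule.isCoatom_comap_iff U.mkQ_surjective |>.2 hN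
  · exact Submodule.le_comap_mkQ U N

/-- To prove that all members satisfy a property stable under intersections and enlargement,
it suffices to treat the maximal ones. -/
theorem induction_isCoatom {p : Ideal R → Prop} (hinf : ∀ {U V}, p U → p V → p (U ⊓ V))
    (htop : p ⊤) (hmax : ∀ M ∈ 𝒪, IsCoatom M → p M) {U : Ideal R} (hU : U ∈ 𝒪) : p U := by
  have := h𝒪.isSemisimpleModule_quotient hU
  -- R/U is semisimple and cyclic, hence artinian. A minimal N whose preimage has p is zero, since
  -- otherwise a maximal left ideal would cut it down.
  obtain ⟨N, hN, hmin⟩ := IsArtinian.set_has_minimal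
    {N : Submodule R (R ⧸ U) | p (N.comap U.mkQ)} ⟨⊤, by simpa using htop⟩
  have hUN : U ≤ N.comap U.mkQ := Submodule.le_comap_mkQ U N
  suffices N.comap U.mkQ = U from this ▸ hN
  refine le_antisymm (fun x hx => ?_) hUN
  by_contra hxU
  obtain ⟨M, hM, hUM, hxM⟩ := h𝒪.exists_isCoatom hU hxU
  have hcm : (Submodule.map U.mkQ M).comap U.mkQ = M := by
    rw [Submodule.comap_map_eq, Submodule.ker_mkQ, sup_eq_left.2 hUM]
  refine hmin (N ⊓ Submodule.map U.mkQ M) ?_ (lt_of_le_of_ne inf_le_left fun h => hxM ?_)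
  · rw [Set.mem_ofPred_eq, Submodule.comap_inf, hcm]
    exact hinf hN (hmax M (h𝒪.mono hU hUM) hM)
  · rw [← hcm]
    exact inf_eq_left.1 h hx

/-- This is semiprimeness. For a minimal left ideal L with idempotent e and a e ≠ 0, the element a e
generates L, so e = r a e and a r a e = a e ≠ 0. -/
theorem exists_mul_mul_ne_zero {a : R} (ha : a ≠ 0) : ∃ r, a * r * a ≠ 0 := by
  obtain ⟨U, hU, haU⟩ := h𝒪.exists_notMem ha
  obtain ⟨M, hM, hUM, haM⟩ := h𝒪.exists_isCoatom hU haU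
  obtain ⟨L, hL⟩ := h𝒪.exists_isCompl (h𝒪.mono hU hUM)
  obtain ⟨e, he, hLe, hMe⟩ := hL.exists_idempotent
  have hLat : IsAtom L := hL.isAtom_iff_isCoatom.2 hM
  have hae : a * e ≠ 0 := fun h => haM ((hMe a).2 h)
  have hspan : Ideal.span {a * e} = L :=
    (hLat.le_iff.1 (Ideal.span_le.2 (by simpa using L.mul_mem_left a he))).resolve_left
      (by simpa using hae)
  obtain ⟨r, hr⟩ := Ideal.mem_span_singleton'.1 (hspan.symm ▸ he : e ∈ Ideal.span {a * e})
  refine ⟨r, fun h => hae ?_⟩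
  rw [← hr, ← mul_assoc, ← mul_assoc, h, zero_mul]

/-- A two-sided ideal in the family is generated by a central idempotent. -/
theorem exists_central {A : Ideal R} (hA : A ∈ 𝒪) [A.IsTwoSided] :
    ∃ e : R, e * e = e ∧ (∀ x, e * x = x * e) ∧ ∀ x, x ∈ A ↔ x * e = 0 := by
  obtain ⟨L, hL⟩ := h𝒪.exists_isCompl hA
  obtain ⟨e, he, hLe, hAe⟩ := hL.exists_idempotent
  have hee : e * e = e := hLe e he
  refine ⟨e, hee, fun x => ?_, hAe⟩
  -- Put z = e x (1 - e), which lies in A. Then z r lies in A, so z r e = 0 and z r z = 0 for all r,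
  -- against semiprimeness.
  have h1 : e * x * (1 - e) = 0 := by
    by_contra hne
    obtain ⟨r, hr⟩ := h𝒪.exists_mul_mul_ne_zero hne
    have hmem : e * x * (1 - e) * r ∈ A := by
      refine Ideal.mul_mem_right _ _ ((hAe _).2 ?_)
      rw [mul_assoc, sub_mul, one_mul, hee, sub_self, mul_zero]
    refine hr ?_
    rw [mul_assoc e x, ← mul_assoc _ e, ← mul_assoc e x, (hAe _).1 hmem, zero_mul]
  have h2 : (1 - e) * x * e = 0 := by
    refine (hAe _).1 (Ideal.mul_mem_right _ _ ((hAe _).2 ?_))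
    rw [sub_mul, one_mul, hee, sub_self]
  have h3 : e * x = e * x * e := by
    rw [← sub_eq_zero, ← h1]; noncomm_ring
  have h4 : x * e = e * x * e := by
    rw [← sub_eq_zero, ← h2]; noncomm_ring
  rw [h3, h4]

/-- The annihilator of a minimal left ideal, if it is in the family, has simple artinian
quotient. -/
theorem isSimpleRing_quotient {L : Ideal R} (hL : IsAtom L)
    (hP : Module.annihilator R L ∈ 𝒪) : IsSimpleRing (R ⧸ Module.annihilator R L) := by
  set P := Module.annihilator R L with hPdef
  have hmem : ∀ {x}, x ∈ P ↔ ∀ v ∈ L, x * v = 0 := by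
    intro x
    rw [hPdef, Module.mem_annihilator]
    simp [Subtype.ext_iff]
  have hnt : Nontrivial (R ⧸ P) := by
    refine Ideal.Quotient.nontrivial_iff.2 fun h => hL.1 ?_
    refine (Submodule.eq_bot_iff _).2 fun v hv => ?_
    exact (one_mul v).symm.trans
      (hmem.1 (h ▸ (Submodule.mem_top : (1 : R) ∈ (⊤ : Ideal R))) v hv)
  refine ⟨⟨fun T => ?_⟩⟩
  let A : Ideal R := (TwoSidedIdeal.asIdeal T).comap (Ideal.Quotient.mk P)
  have hAmem : ∀ {x}, x ∈ A ↔ Ideal.Quotient.mk P x ∈ T := by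
    intro x; simp [A, Ideal.mem_comap]
  have hPA : P ≤ A := fun x hx => by
    rw [hAmem, Ideal.Quotient.eq_zero_iff_mem.2 hx]
    exact T.zero_mem
  have hA2 : A.IsTwoSided := ⟨fun {a} b ha => by
    rw [hAmem] at ha ⊢
    rw [map_mul]
    exact T.mul_mem_right _ _ ha⟩
  obtain ⟨e, hee, hec, hAe⟩ := h𝒪.exists_central (h𝒪.mono hP hPA)
  -- Either e kills L, and then e ∈ P ≤ A gives e = 0 and A = R; or L is generated by some e w, and
  -- A kills L because A e = 0 and e is central.
  by_cases he : ∀ v ∈ L, e * v = 0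
  · right
    rw [eq_top_iff]
    intro y _
    obtain ⟨x, rfl⟩ := Ideal.Quotient.mk_surjective y
    rw [← hAmem]
    have heA : e = 0 := by
      rw [← hee]
      exact (hAe e).1 (hPA (hmem.2 he))
    rw [hAe, heA, mul_zero]
  · left
    push Not at he
    obtain ⟨w, hw, hew⟩ := he
    have hspan : Ideal.span {e * w} = L :=
      (hL.le_iff.1 (Ideal.span_le.2 (by simpa using L.mul_mem_left e hw))).resolve_left
        (by simpa using hew)
    rw [eq_bot_iff]
    intro y hy
    obtain ⟨x, rfl⟩ := Ideal.Quotient.mk_surjective y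
    rw [← hAmem, hAe] at hy
    rw [TwoSidedIdeal.mem_bot, Ideal.Quotient.eq_zero_iff_mem, hmem]
    intro v hv
    obtain ⟨r, rfl⟩ := Ideal.mem_span_singleton'.1 (hspan.symm ▸ hv : v ∈ Ideal.span {e * w})
    rw [← mul_assoc r, ← hec, mul_assoc e, ← mul_assoc, hy, zero_mul]

theorem isArtinianRing_quotient {P : Ideal R} [P.IsTwoSided] (hP : P ∈ 𝒪) :
    IsArtinianRing (R ⧸ P) := by
  have := h𝒪.isSemisimpleModule_quotient hP
  exact isArtinian_of_tower R (S := R ⧸ P) (M := R ⧸ P) inferInstance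

end IsSemisimpleFamily

/-- The two-sided ideal cut out by a central idempotent. -/
theorem exists_twoSidedIdeal_of_central {S : Type*} [Ring S] {P : Ideal R} [P.IsTwoSided] {e : R}
    (hee : e * e = e) (hec : ∀ x, e * x = x * e) (hP : ∀ x, x ∈ P ↔ x * e = 0)
    (ψ : (R ⧸ P) ≃+* S) :
    ∃ I J : TwoSidedIdeal R, IsCompl I J ∧ (∀ x, x ∈ I ↔ x * e = x) ∧ Nonempty (I ≃+* S) := by
  let I : TwoSidedIdeal R := .mk' {x | x * e = x} (zero_mul e)
    (fun {x y} (hx : x * e = x) (hy : y * e = y) => show (x + y) * e = x + y by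
      rw [add_mul, hx, hy])
    (fun {x} (hx : x * e = x) => show -x * e = -x by rw [neg_mul, hx])
    (fun {x y} (hy : y * e = y) => show x * y * e = x * y by rw [mul_assoc, hy])
    (fun {x y} (hx : x * e = x) => show x * y * e = x * y by rw [mul_assoc, ← hec, ← mul_assoc, hx])
  have hI : ∀ x, x ∈ I ↔ x * e = x := fun x => TwoSidedIdeal.mem_mk' ..
  let J : TwoSidedIdeal R := .mk' {x | x * e = 0} (zero_mul e)
    (fun {x y} (hx : x * e = 0) (hy : y * e = 0) => show (x + y) * e = 0 by
      rw [add_mul, hx, hy, add_zero])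
    (fun {x} (hx : x * e = 0) => show -x * e = 0 by rw [neg_mul, hx, neg_zero])
    (fun {x y} (hy : y * e = 0) => show x * y * e = 0 by rw [mul_assoc, hy, mul_zero])
    (fun {x y} (hx : x * e = 0) => show x * y * e = 0 by
      rw [mul_assoc, ← hec, ← mul_assoc, hx, zero_mul])
  have hJ : ∀ x, x ∈ J ↔ x * e = 0 := fun x => TwoSidedIdeal.mem_mk' ..
  have hcompl : IsCompl I J := by
    refine ⟨disjoint_iff.2 (eq_bot_iff.2 fun x hx => ?_),
      codisjoint_iff.2 (eq_top_iff.2 fun x _ => ?_)⟩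
    · rw [TwoSidedIdeal.mem_inf, hI, hJ] at hx
      rw [TwoSidedIdeal.mem_bot, ← hx.1, hx.2]
    · refine TwoSidedIdeal.mem_sup.2 ⟨x * e, (hI _).2 ?_, x - x * e, (hJ _).2 ?_, by abel⟩
      · rw [mul_assoc, hee]
      · rw [sub_mul, mul_assoc, hee, sub_self]
  let g : I →ₙ+* (R ⧸ P) :=
    { toFun := fun x => Ideal.Quotient.mk P x
      map_mul' := fun x y => map_mul _ _ _
      map_zero' := map_zero _
      map_add' := fun x y => map_add _ _ _ }
  have hg : Function.Bijective g := by
    constructor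
    · rw [injective_iff_map_eq_zero]
      rintro ⟨x, hx⟩ h
      have h1 : x * e = 0 := (hP x).1 (Ideal.Quotient.eq_zero_iff_mem.1 h)
      exact Subtype.ext (((hI x).1 hx).symm.trans h1)
    · intro y
      obtain ⟨x, rfl⟩ := Ideal.Quotient.mk_surjective y
      refine ⟨⟨x * e, (hI _).2 (by rw [mul_assoc, hee])⟩, ?_⟩
      change Ideal.Quotient.mk P (x * e) = Ideal.Quotient.mk P x
      rw [Ideal.Quotient.eq, hP, sub_mul, mul_assoc, hee, sub_self]
  exact ⟨I, J, hcompl, hI, ⟨(RingEquiv.ofBijective g hg).trans ψ⟩⟩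

end SemisimpleFilter

/-! ### Opening left ideals in a coarser Hausdorff ring topology -/

section CoarserTopology

theorem topologicalRing_of_injective {A B : Type*} [NonUnitalRing A] [NonUnitalRing B]
    [TopologicalSpace B] [IsTopologicalRing B] [T2Space B] (f : A →ₙ+* B)
    (hf : Function.Injective f) :
    @IsTopologicalRing A (TopologicalSpace.induced f inferInstance) _ ∧
      @T2Space A (TopologicalSpace.induced f inferInstance) := by
  let : TopologicalSpace A := TopologicalSpace.induced f inferInstance
  have hfi : IsInducing f := ⟨rfl⟩
  refine ⟨?_, T2Space.of_injective_continuous hf hfi.continuous⟩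
  refine { continuous_add := ?_, continuous_mul := ?_, continuous_neg := ?_ }
  · refine hfi.continuous_iff.2 ?_
    have : (f ∘ fun p : A × A => p.1 + p.2) = fun p => f p.1 + f p.2 := by ext; simp
    rw [this]
    exact (hfi.continuous.comp continuous_fst).add (hfi.continuous.comp continuous_snd)
  · refine hfi.continuous_iff.2 ?_
    have : (f ∘ fun p : A × A => p.1 * p.2) = fun p => f p.1 * f p.2 := by ext; simp
    rw [this]
    exact (hfi.continuous.comp continuous_fst).mul (hfi.continuous.comp continuous_snd)
  · refine hfi.continuous_iff.2 ?_
    have : (f ∘ fun p : A => -p) = fun p => -f p := by ext; simp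
    rw [this]
    exact hfi.continuous.neg

variable {R : Type*} [Ring R] [TopologicalSpace R] [IsTopologicalRing R]

theorem isOpen_ideal_of_nhds {P : Ideal R} {W : Set R} (hW : W ∈ 𝓝 (0 : R)) (hWP : W ⊆ P) :
    IsOpen (P : Set R) :=
  P.toAddSubgroup.isOpen_of_mem_nhds (Filter.mem_of_superset hW hWP)

/-- If a two-sided direct summand is a matrix ring over a division ring which admits only the
discrete topology, then the complement is open. -/
theorem isOpen_of_matrix_summand [T2Space R] {P : Ideal R} {e : R} (hee : e * e = e)
    (hP : ∀ x, x ∈ P ↔ x * e = 0) {I : TwoSidedIdeal R}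
    (hI : ∀ x, x ∈ I ↔ x * e = x) {n : ℕ} (hn : 0 < n) {Δ : Type*} [DivisionRing Δ]
    (φ : I ≃+* Matrix (Fin n) (Fin n) Δ) (hΔ : ¬ AdmitsNondiscreteHausdorffRingTopology Δ) :
    IsOpen (P : Set R) := by
  have : Nonempty (Fin n) := ⟨⟨0, hn⟩⟩
  let h : Δ →ₙ+* R :=
    { toFun := fun d => φ.symm (Matrix.scalar (Fin n) d)
      map_mul' := fun a b => by rw [map_mul, map_mul]; rfl
      map_zero' := by rw [map_zero, map_zero]; rfl
      map_add' := fun a b => by rw [map_add, map_add]; rfl }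
  have hinj : Function.Injective h := fun a b hab =>
    Matrix.scalar_inj.1 (φ.symm.injective (Subtype.ext hab))
  obtain ⟨h1, h2⟩ := topologicalRing_of_injective h hinj
  have hdisc : @DiscreteTopology Δ (TopologicalSpace.induced h inferInstance) := by
    by_contra hnd
    exact hΔ ⟨_, h1, h2, hnd⟩
  have hN : ∃ N ∈ 𝓝 (0 : R), ∀ d, h d ∈ N → d = 0 := by
    let : TopologicalSpace Δ := TopologicalSpace.induced h inferInstance
    have hmem : ({0} : Set Δ) ∈ 𝓝 (0 : Δ) := (isOpen_discrete _).mem_nhds rfl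
    rw [nhds_induced, Filter.mem_comap, map_zero] at hmem
    obtain ⟨N, hN, hsub⟩ := hmem
    exact ⟨N, hN, fun d hd => hsub hd⟩
  obtain ⟨N, hN, hN0⟩ := hN
  -- With matrix units E, the sum of E k i * m * E j k over k is the scalar matrix of the entry m i
  -- j, so `T` reads off entries continuously.
  let E : Fin n → Fin n → R := fun i j => φ.symm (Matrix.single i j 1)
  let T : Fin n → Fin n → R → R := fun i j x => ∑ k, E k i * (x * e) * E j k
  have hTc : ∀ i j, Continuous (T i j) := fun i j => by fun_prop
  have hT0 : ∀ i j, T i j 0 = 0 := fun i j => by simp [T]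
  refine isOpen_ideal_of_nhds (W := ⋂ i, ⋂ j, T i j ⁻¹' N)
    (Filter.iInter_mem.2 fun i => Filter.iInter_mem.2 fun j =>
      (hTc i j).continuousAt.preimage_mem_nhds (by rwa [hT0])) ?_
  intro x hx
  simp only [Set.mem_iInter, Set.mem_preimage] at hx
  have hxe : x * e ∈ I := (hI _).2 (by rw [mul_assoc, hee])
  set m := φ ⟨x * e, hxe⟩ with hm
  have hTh : ∀ i j, T i j x = h (m i j) := by
    intro i j
    have hsum : Matrix.scalar (Fin n) (m i j) =
        ∑ k, Matrix.single k i 1 * m * Matrix.single j k (1 : Δ) := by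
      ext a b
      rw [Matrix.sum_apply]
      simp only [Matrix.single_mul_mul_single, one_mul, mul_one, Matrix.scalar_apply,
        Matrix.single_apply, Matrix.diagonal_apply]
      by_cases hab : a = b
      · subst hab; simp
      · rw [if_neg hab]
        refine (Finset.sum_eq_zero fun k _ => if_neg ?_).symm
        rintro ⟨rfl, rfl⟩
        exact hab rfl
    have hmx : ((φ.symm m : I) : R) = x * e := by rw [hm, RingEquiv.symm_apply_apply]
    change _ = ((φ.symm (Matrix.scalar (Fin n) (m i j)) : I) : R)
    have hcoe : ∀ s : Finset (Fin n), ∀ f : Fin n → I,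
        ((∑ k ∈ s, f k : I) : R) = ∑ k ∈ s, (f k : R) := fun s f =>
      map_sum ((⟨⟨Subtype.val, rfl⟩, fun _ _ => rfl⟩ : I →+ R)) f s
    rw [hsum, map_sum, hcoe]
    refine Finset.sum_congr rfl fun k _ => ?_
    rw [map_mul, map_mul, ← hmx]
    rfl
  have hm0 : m = 0 := by
    ext i j
    exact hN0 _ (hTh i j ▸ hx i j)
  have : (⟨x * e, hxe⟩ : I) = 0 := (map_eq_zero_iff φ φ.injective).1 hm0
  exact (hP x).2 (congrArg Subtype.val this)

/-- The case of a minimal left ideal that is not annihilated by a member of the family. -/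
theorem IsSemisimpleFamily.isOpen_of_annihilator_notMem [T2Space R] {𝒪 : Set (Ideal R)}
    (h𝒪 : IsSemisimpleFamily 𝒪) (hsmall : ∀ W ∈ 𝓝 (0 : R), ∃ U ∈ 𝒪, (U : Set R) ⊆ W)
    {L M : Ideal R} (hL : IsAtom L) (hLM : IsCompl L M)
    (hann : ∀ U ∈ 𝒪, ∃ u ∈ U, ∃ v ∈ L, u * v ≠ 0) : IsOpen (M : Set R) := by
  obtain ⟨e, he, hLe, hMe⟩ := hLM.exists_idempotent
  have hspan : ∀ v ∈ L, v ≠ 0 → Ideal.span {v} = L := fun v hv hv0 =>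
    (hL.le_iff.1 (Ideal.span_le.2 (by simpa using hv))).resolve_left (by simpa using hv0)
  obtain ⟨w, hw, hw0⟩ := (Submodule.ne_bot_iff _).1 hL.1
  let p : Ideal R → Prop := fun V => ∃ N ∈ 𝓝 (0 : R), ∀ v ∈ L, v ∈ N → ∀ u ∈ V, u * v = 0
  have hstart : ∃ U ∈ 𝒪, p U := by
    have hmul : Filter.Tendsto (fun q : R × R => q.1 * q.2) (𝓝 0 ×ˢ 𝓝 0) (𝓝 0) := by
      rw [← nhds_prod_eq]
      exact (continuous_mul.tendsto' (0, 0) 0 (mul_zero 0))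
    -- The product W N avoids w. If u v ≠ 0 with u in U ⊆ W and v in L ∩ N, then w = (r u) v for
    -- some r, a contradiction.
    obtain ⟨W, hW, N, hN, hWN⟩ := Filter.mem_prod_iff.1
      (hmul (isOpen_compl_singleton.mem_nhds hw0.symm : {w}ᶜ ∈ 𝓝 (0 : R)))
    obtain ⟨U, hU, hUW⟩ := hsmall W hW
    refine ⟨U, hU, N, hN, fun v hv hvN u hu => ?_⟩
    by_contra huv
    obtain ⟨r, hr⟩ := Ideal.mem_span_singleton'.1
      ((hspan _ (L.mul_mem_left u hv) huv).symm ▸ hw : w ∈ Ideal.span {u * v})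
    exact hWN (Set.mk_mem_prod (hUW (U.mul_mem_left r hu)) hvN)
      ((mul_assoc r u v).trans hr)
  obtain ⟨U, hU, hpU⟩ := hstart
  have := h𝒪.isSemisimpleModule_quotient hU
  -- A largest V ⊇ U killing all small elements of L exists since R/U is noetherian. It is
  -- two-sided: V + V r has the same property, because r v is small when v is.
  obtain ⟨Q, ⟨hpQ, hQge⟩, hmax⟩ := set_has_maximal_iff_noetherian.2
    (inferInstance : IsNoetherian R (R ⧸ U))
    {Q : Submodule R (R ⧸ U) | p (Q.comap U.mkQ) ∧ U ≤ Q.comap U.mkQ}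
    ⟨⊥, by simpa [Submodule.comap_bot] using hpU, Submodule.le_comap_mkQ U ⊥⟩
  set V : Ideal R := Q.comap U.mkQ with hV
  have hstep : ∀ u ∈ V, ∀ r, u * r ∈ V := by
    intro u hu r
    let V' : Ideal R := V ⊔ Submodule.map (LinearMap.toSpanSingleton R R r) V
    have hUV' : U ≤ V' := hQge.trans le_sup_left
    have hcm : Submodule.comap U.mkQ (Submodule.map U.mkQ V') = V' := by
      rw [Submodule.comap_map_eq, Submodule.ker_mkQ, sup_eq_left.2 hUV']
    have hle : Q ≤ Submodule.map U.mkQ V' := by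
      rw [← Submodule.map_comap_eq_of_surjective U.mkQ_surjective Q, ← hV]
      exact Submodule.map_mono le_sup_left
    have hpV' : p V' := by
      obtain ⟨N, hN, hNV⟩ := hpQ
      refine ⟨N ∩ (fun x => r * x) ⁻¹' N, Filter.inter_mem hN
        ((continuous_const_mul r).continuousAt.preimage_mem_nhds (by simpa using hN)), ?_⟩
      intro v hv hvN y hy
      obtain ⟨a, ha, b, hb, rfl⟩ := Submodule.mem_sup.1 hy
      obtain ⟨c, hc, rfl⟩ := hb
      rw [add_mul, hNV v hv hvN.1 a ha, zero_add, LinearMap.toSpanSingleton_apply, smul_eq_mul,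
        mul_assoc]
      exact hNV _ (L.mul_mem_left r hv) hvN.2 c hc
    have heq : Q = Submodule.map U.mkQ V' := by
      by_contra hne
      exact hmax _ ⟨by rwa [hcm], by rwa [hcm]⟩ (lt_of_le_of_ne hle hne)
    have hVV' : V = V' := by rw [hV, heq, hcm]
    rw [hVV']
    exact Submodule.mem_sup_right ⟨u, hu, rfl⟩
  obtain ⟨N, hN, hNV⟩ := hpQ
  -- A nonzero small v generates L, so V L = V R v ⊆ V v = 0, against `hann`.
  have hN0 : ∀ v ∈ L, v ∈ N → v = 0 := by
    intro v hv hvN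
    by_contra hv0
    obtain ⟨u, hu, w', hw', hne⟩ := hann V (h𝒪.mono hU hQge)
    obtain ⟨r, rfl⟩ := Ideal.mem_span_singleton'.1
      ((hspan v hv hv0).symm ▸ hw' : w' ∈ Ideal.span {v})
    exact hne (by rw [← mul_assoc]; exact hNV v hv hvN _ (hstep u hu r))
  refine isOpen_ideal_of_nhds (W := (fun x => x * e) ⁻¹' N)
    ((continuous_mul_const e).continuousAt.preimage_mem_nhds (by simpa using hN)) fun x hx => ?_
  exact (hMe x).2 (hN0 _ (L.mul_mem_left x he) hx)

end CoarserTopology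

/-- A Hausdorff ring topology whose neighbourhoods of zero contain members of a semisimple family
contains all members of the family as open ideals, unless there is a matrix ring summand. -/
theorem IsSemisimpleFamily.isOpen_of_forall_nhds {R : Type u} [Ring R] [TopologicalSpace R]
    [IsTopologicalRing R] [T2Space R] {𝒪 : Set (Ideal R)}
    (h𝒪 : IsSemisimpleFamily 𝒪) (hsmall : ∀ W ∈ 𝓝 (0 : R), ∃ U ∈ 𝒪, (U : Set R) ⊆ W)
    (hno : ¬ ∃ (n : ℕ) (Δ : Type u) (_ : DivisionRing Δ), 0 < n ∧
        HasDirectSummand R (Matrix (Fin n) (Fin n) Δ) ∧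
        AdmitsNondiscreteHausdorffRingTopology Δ) {U : Ideal R} (hU : U ∈ 𝒪) :
    IsOpen (U : Set R) := by
  refine h𝒪.induction_isCoatom (p := fun U => IsOpen (U : Set R)) (fun h1 h2 => h1.inter h2)
    isOpen_univ (fun M hM hMc => ?_) hU
  obtain ⟨L, hLM⟩ := h𝒪.exists_isCompl hM
  have hL : IsAtom L := hLM.isAtom_iff_isCoatom.2 hMc
  by_cases hann : ∀ U ∈ 𝒪, ∃ u ∈ U, ∃ v ∈ L, u * v ≠ 0
  · exact h𝒪.isOpen_of_annihilator_notMem hsmall hL hLM hann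
  · push Not at hann
    obtain ⟨V, hV, hVL⟩ := hann
    set P := Module.annihilator R L with hPdef
    have hmem : ∀ {x}, x ∈ P ↔ ∀ v ∈ L, x * v = 0 := by
      intro x
      rw [hPdef, Module.mem_annihilator]
      simp [Subtype.ext_iff]
    have hP : P ∈ 𝒪 := h𝒪.mono hV fun u hu => hmem.2 fun v hv => hVL u hu v hv
    have := h𝒪.isSimpleRing_quotient hL hP
    have := h𝒪.isArtinianRing_quotient hP
    obtain ⟨n, hn, Δ, _, ⟨ψ⟩⟩ := IsSimpleRing.exists_ringEquiv_matrix_divisionRing (R ⧸ P)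
    obtain ⟨e, hee, hec, hPe⟩ := h𝒪.exists_central hP
    obtain ⟨I, J, hIJ, hI, ⟨φ⟩⟩ := exists_twoSidedIdeal_of_central hee hec hPe ψ
    have hPo : IsOpen (P : Set R) :=
      isOpen_of_matrix_summand hee hPe hI (Nat.pos_of_ne_zero hn.out) φ fun hΔ =>
        hno ⟨n, Δ, _, Nat.pos_of_ne_zero hn.out, ⟨I, J, hIJ, ⟨φ⟩⟩, hΔ⟩
    obtain ⟨l, hl, -, hMl⟩ := hLM.exists_idempotent
    exact isOpen_ideal_of_nhds (hPo.mem_nhds P.zero_mem) fun x hx => (hMl x).2 (hmem.1 hx l hl)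

/-! ### Necessity: a matrix summand yields a strictly coarser topology -/

/-- A ring is retracted onto a two-sided direct summand with an identity by a ring homomorphism. -/
theorem exists_retraction_of_isCompl {R S : Type*} [NonUnitalRing R] [Ring S] {I J : TwoSidedIdeal R}
    (hIJ : IsCompl I J) (φ : I ≃+* S) :
    ∃ f : R →ₙ+* S, ∀ x : I, f x = φ x := by
  set e : I := φ.symm 1 with he
  have heI : ∀ x : I, x * e = x ∧ e * x = x := fun x => by
    constructor <;> apply φ.injective <;> rw [map_mul, he, RingEquiv.apply_symm_apply] <;> simp
  have hdisj : ∀ x ∈ I, x ∈ J → x = 0 := fun x hI hJ => by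
    have h : x ∈ I ⊓ J := (TwoSidedIdeal.mem_inf R).2 ⟨hI, hJ⟩
    rwa [hIJ.inf_eq_bot, TwoSidedIdeal.mem_bot] at h
  have hdec : ∀ x : R, ∃ i : I, ∃ j ∈ J, (i : R) + j = x := fun x => by
    have h : x ∈ I ⊔ J := hIJ.sup_eq_top ▸ TwoSidedIdeal.mem_top ..
    obtain ⟨i, hi, j, hj, h⟩ := TwoSidedIdeal.mem_sup.1 h
    exact ⟨⟨i, hi⟩, j, hj, h⟩
  have hcomp : ∀ (i : I), ∀ j ∈ J, (i + j : R) * e = i := fun i j hj => by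
    have h0 : j * (e : R) = 0 := hdisj _ (I.mul_mem_left _ _ e.2) (J.mul_mem_right _ _ hj)
    have h1 : (i : R) * e = i := congrArg Subtype.val (heI i).1
    rw [add_mul, h0, h1, add_zero]
  have hcomp' : ∀ (i : I), ∀ j ∈ J, (e : R) * (i + j : R) = i := fun i j hj => by
    have h0 : (e : R) * j = 0 := hdisj _ (I.mul_mem_right _ _ e.2) (J.mul_mem_left _ _ hj)
    have h1 : (e : R) * i = i := congrArg Subtype.val (heI i).2
    rw [mul_add, h0, h1, add_zero]
  have hcentral : ∀ x : R, (e : R) * x = x * e := fun x => by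
    obtain ⟨i, j, hj, rfl⟩ := hdec x
    rw [hcomp i j hj, hcomp' i j hj]
  let g : R →ₙ+* I :=
    { toFun := fun x => ⟨x * e, I.mul_mem_left _ _ e.2⟩
      map_mul' := fun x y => Subtype.ext <| by
        have hee : (e : R) * e = e := congrArg Subtype.val (heI e).1
        change x * y * (e : R) = x * e * (y * e)
        rw [mul_assoc x e, ← mul_assoc (e : R), hcentral y, mul_assoc y, hee, mul_assoc]
      map_zero' := Subtype.ext (zero_mul _)
      map_add' := fun x y => Subtype.ext (add_mul _ _ _) }
  refine ⟨(φ : I →ₙ+* S).comp g, fun x => ?_⟩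
  have : g x = x := (heI x).1
  exact congrArg φ this

/-- In a linearly topologized Hausdorff ring the kernel of a split surjection onto an artinian
ring is open. -/
theorem IsLeftLinearlyCompact.isOpen_of_artinian_summand {R S : Type*} [NonUnitalRing R]
    [TopologicalSpace R] (hlc : IsLeftLinearlyCompact R) [Ring S] [IsArtinianRing S]
    {I : TwoSidedIdeal R} (φ : I ≃+* S) (f : R →ₙ+* S)
    (hf : ∀ x : I, f x = φ x) : {x : R | f x = 0} ∈ 𝓝 (0 : R) := by
  have := hlc.isTopologicalRing
  let tr : {U : AddSubgroup R // IsLeftIdeal U} → Ideal S := fun U =>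
    { carrier := {s | (φ.symm s : R) ∈ U.1}
      zero_mem' := by
        change ((φ.symm 0 : I) : R) ∈ U.1
        rw [map_zero]; exact U.1.zero_mem
      add_mem' := fun {a b} ha hb => by
        change ((φ.symm (a + b) : I) : R) ∈ U.1
        rw [map_add]; exact U.1.add_mem ha hb
      smul_mem' := fun a b hb => by
        change ((φ.symm (a * b) : I) : R) ∈ U.1
        rw [map_mul]; exact U.2 _ _ hb }
  -- A minimal trace on S of an open left ideal exists since S is artinian; the Hausdorff property
  -- forces it to be zero.
  obtain ⟨N, ⟨U, hUo, rfl⟩, hmin⟩ := IsArtinian.set_has_minimal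
    (tr '' {U | IsOpen (U.1 : Set R)})
    ⟨_, ⟨⊤, fun _ _ _ => AddSubgroup.mem_top _⟩, isOpen_univ, rfl⟩
  have h0 : ∀ s ∈ tr U, s = 0 := by
    intro s hs
    by_contra hs0
    have hne : ((φ.symm s : I) : R) ≠ 0 := fun h =>
      hs0 ((map_eq_zero_iff φ.symm φ.symm.injective).1 (Subtype.ext h))
    obtain ⟨V, hV, hVo, hnot⟩ := hlc.exists_notMem hne
    refine hmin (tr ⟨U.1 ⊓ V, U.2.inf hV⟩) ⟨_, hUo.inter hVo, rfl⟩ (lt_of_le_of_ne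
      (fun s hs => hs.1) fun h => ?_)
    have : s ∈ tr ⟨U.1 ⊓ V, U.2.inf hV⟩ := h ▸ hs
    exact hnot this.2
  have hcont : Continuous fun x : R => (φ.symm 1 : R) * x := by fun_prop
  refine Filter.mem_of_superset (hcont.continuousAt.preimage_mem_nhds
    (by rw [mul_zero]; exact hUo.mem_nhds U.1.zero_mem)) fun x hx => ?_
  have hmem : f x ∈ tr U := by
    change ((φ.symm (f x) : I) : R) ∈ U.1
    have h1 : φ.symm (f x) = ⟨(φ.symm 1 : R) * x, I.mul_mem_right _ _ (φ.symm 1).2⟩ := by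
      rw [RingEquiv.symm_apply_eq, ← hf]
      change f x = f ((φ.symm 1 : R) * x)
      rw [map_mul, hf, RingEquiv.apply_symm_apply, one_mul]
    rw [h1]
    exact hx
  exact h0 _ hmem

/-- A minimal linearly compact ring has no matrix ring summand over a division ring with a
nondiscrete topology. -/
theorem IsMinimalTopologicalRing.not_hasDirectSummand {R : Type*} [NonUnitalRing R]
    [t : TopologicalSpace R] (hlc : IsLeftLinearlyCompact R) (hmin : IsMinimalTopologicalRing R)
    {n : ℕ} (hn : 0 < n) {Δ : Type*} [DivisionRing Δ]
    (hΔ : AdmitsNondiscreteHausdorffRingTopology Δ) :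
    ¬ HasDirectSummand R (Matrix (Fin n) (Fin n) Δ) := by
  rintro ⟨I, J, hIJ, ⟨φ⟩⟩
  obtain ⟨u, hu, hu2, hnd⟩ := hΔ
  have := hlc.isTopologicalRing
  have := hlc.t2Space
  have : Nonempty (Fin n) := ⟨⟨0, hn⟩⟩
  obtain ⟨f, hf⟩ := exists_retraction_of_isCompl hIJ φ
  have hker := hlc.isOpen_of_artinian_summand φ f hf
  -- This is the projection onto the kernel of f along I; it is multiplicative because these two
  -- ideals annihilate each other.
  let g : R →ₙ+* R :=
    { toFun := fun x => x - φ.symm (f x)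
      map_mul' := fun x y => by
        have hx : f (x - φ.symm (f x)) = 0 := by rw [map_sub, hf]; simp
        have hy : f (y - φ.symm (f y)) = 0 := by rw [map_sub, hf]; simp
        have hd : ∀ z ∈ I, f z = 0 → z = 0 := fun z hz h => by
          have := hf ⟨z, hz⟩
          rw [h, eq_comm, map_eq_zero_iff φ φ.injective] at this
          exact congrArg Subtype.val this
        have h1 : (x - φ.symm (f x)) * (φ.symm (f y) : R) = 0 :=
          hd _ (I.mul_mem_left _ _ (φ.symm (f y)).2) (by rw [map_mul, hx, zero_mul])
        have h2 : (φ.symm (f x) : R) * (y - φ.symm (f y)) = 0 :=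
          hd _ (I.mul_mem_right _ _ (φ.symm (f x)).2) (by rw [map_mul, hy, mul_zero])
        have h3 : ((φ.symm (f (x * y)) : I) : R) = φ.symm (f x) * φ.symm (f y) := by
          rw [map_mul, map_mul]; rfl
        rw [h3, mul_sub, h1, sub_zero, sub_mul]
        rw [mul_sub, sub_eq_zero] at h2
        rw [h2]
      map_zero' := by rw [map_zero, map_zero]; exact sub_zero _
      map_add' := fun x y => by
        have h3 : ((φ.symm (f (x + y)) : I) : R) = φ.symm (f x) + φ.symm (f y) := by
          rw [map_add, map_add]; rfl
        rw [h3]; abel }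
  have hg : ∀ x, g x = x - φ.symm (f x) := fun _ => rfl
  let F : R →ₙ+* Matrix (Fin n) (Fin n) Δ × R := f.prod g
  have hF : ∀ x, F x = (f x, g x) := fun _ => rfl
  have hinj : Function.Injective F := by
    rw [injective_iff_map_eq_zero]
    intro x hx
    rw [hF, Prod.mk_eq_zero, hg] at hx
    have h := hx.2
    rw [hx.1, map_zero] at h
    simpa using h
  -- The new topology uses u on matrix entries and the given topology on the kernel of f; it is
  -- coarser because that kernel is open.
  obtain ⟨h1, h2⟩ := topologicalRing_of_injective F hinj
  have hfc : Continuous f := by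
    refine continuous_of_continuousAt_zero f.toAddMonoidHom ?_
    change Filter.Tendsto f (𝓝 0) (𝓝 (f 0))
    rw [map_zero]
    exact tendsto_const_nhds.congr' (Filter.mem_of_superset hker fun x (hx : f x = 0) => hx.symm)
  have hgc : Continuous g := by
    refine continuous_of_continuousAt_zero g.toAddMonoidHom ?_
    change Filter.Tendsto g (𝓝 0) (𝓝 (g 0))
    rw [map_zero]
    refine Filter.tendsto_id.congr' (Filter.mem_of_superset hker fun x (hx : f x = 0) => ?_)
    change x = g x
    rw [hg, hx, map_zero]
    exact (sub_zero x).symm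
  have hle : t ≤ TopologicalSpace.induced F inferInstance :=
    continuous_iff_le_induced.1 (hfc.prodMk hgc)
  have heq := hmin _ h1 h2 hle
  -- By minimality the kernel of f is a neighbourhood of 0 in the new topology too; testing it on
  -- scalar matrices makes u discrete.
  have hnhds : @nhds R t 0 = Filter.comap F (𝓝 (F 0)) := by
    rw [← nhds_induced, heq]
  rw [hnhds, map_zero] at hker
  obtain ⟨N, hN, hsub⟩ := hker
  let h : Δ → Matrix (Fin n) (Fin n) Δ × R := fun d => (Matrix.scalar (Fin n) d, 0)
  have hhc : Continuous h := by
    refine Continuous.prodMk ?_ continuous_const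
    exact
      (continuous_pi fun _ => continuous_id : Continuous fun (d : Δ) (_ : Fin n) => d).matrix_diagonal
  have hpre : h ⁻¹' N ∈ 𝓝 (0 : Δ) := hhc.continuousAt.preimage_mem_nhds (by
    have h0 : h 0 = 0 := by simp [h]
    rwa [h0])
  refine hnd ?_
  refine discreteTopology_of_isOpen_singleton_zero ?_
  refine isOpen_singleton_iff_nhds_eq_pure _ |>.2 (le_antisymm ?_ (pure_le_nhds _))
  rw [Filter.le_pure_iff]
  refine Filter.mem_of_superset hpre fun d hd => ?_
  have hfd : f (φ.symm (Matrix.scalar (Fin n) d) : I) = Matrix.scalar (Fin n) d := by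
    rw [hf, RingEquiv.apply_symm_apply]
  have hFd : F (φ.symm (Matrix.scalar (Fin n) d) : I) = h d := by
    rw [hF, hg, hfd, sub_self]
  have h0 : f (φ.symm (Matrix.scalar (Fin n) d) : I) = 0 :=
    hsub (show F _ ∈ N by rw [hFd]; exact hd)
  rw [hfd] at h0
  exact Matrix.scalar_inj.1 (h0.trans (map_zero _).symm)

/-! ### Sufficiency and the final equivalence -/

/-- The open left ideals of a linearly compact semisimple ring form a semisimple family. -/
theorem IsLeftLinearlyCompact.isSemisimpleFamily {R : Type*} [Ring R] [TopologicalSpace R]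
    (hlc : IsLeftLinearlyCompact R) (hss : IsJacobsonSemisimple R) :
    IsSemisimpleFamily {U : Ideal R | IsOpen (U : Set R)} := by
  have := hlc.isTopologicalRing
  refine ⟨fun {U V} hU hUV => ?_, fun {U} hU => hlc.exists_isCompl hss
    (U.toAddSubgroup.isClosed_of_isOpen hU), fun {x} hx => ?_⟩
  · exact AddSubgroup.isOpen_mono (H₁ := U.toAddSubgroup) (H₂ := V.toAddSubgroup) hUV hU
  · obtain ⟨U, hU, hUo, hxU⟩ := hlc.exists_notMem hx
    exact ⟨{ U with smul_mem' := fun r x hx => hU r x hx }, hUo, hxU⟩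

theorem IsLeftLinearlyCompact.isMinimalTopologicalRing {R : Type u} [Ring R]
    [t : TopologicalSpace R] (hlc : IsLeftLinearlyCompact R) (hss : IsJacobsonSemisimple R)
    (hno : ¬ ∃ (n : ℕ) (Δ : Type u) (_ : DivisionRing Δ), 0 < n ∧
        HasDirectSummand R (Matrix (Fin n) (Fin n) Δ) ∧
        AdmitsNondiscreteHausdorffRingTopology Δ) : IsMinimalTopologicalRing R := by
  have htr := hlc.isTopologicalRing
  have htg : IsTopologicalAddGroup R := inferInstance
  have hfam := hlc.isSemisimpleFamily hss
  have hlin : ∀ W ∈ @nhds R t 0, ∃ U : Ideal R, @IsOpen R t U ∧ (U : Set R) ⊆ W := fun W hW => by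
    obtain ⟨U, hU, hU0, hUW⟩ := hlc.linear W hW
    exact ⟨{ U with smul_mem' := fun r x hx => hU r x hx }, U.isOpen_of_mem_nhds hU0, hUW⟩
  intro u hu hu2 hle
  refine IsTopologicalAddGroup.ext hu.to_topologicalAddGroup htg
    (le_antisymm ?_ ?_)
  · intro W hW
    obtain ⟨U, hU, hUW⟩ := hlin W hW
    -- Neighbourhoods of 0 for u are neighbourhoods for t, so they contain t-open left ideals, as
    -- the smallness hypothesis demands.
    have hUo : @IsOpen R u U := @IsSemisimpleFamily.isOpen_of_forall_nhds R _ u hu hu2 _ hfam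
      (fun W hW => hlin W (nhds_mono hle hW)) hno U hU
    exact Filter.mem_of_superset ((@IsOpen.mem_nhds_iff R u 0 U hUo).2 U.zero_mem) hUW
  · exact nhds_mono hle

theorem corollary2 {R : Type u} [NonUnitalRing R] [TopologicalSpace R]
    (hlc : IsLeftLinearlyCompact R) (hss : IsJacobsonSemisimple R) :
    IsMinimalTopologicalRing R ↔
      ¬ ∃ (n : ℕ) (Δ : Type u) (_ : DivisionRing Δ), 0 < n ∧
        HasDirectSummand R (Matrix (Fin n) (Fin n) Δ) ∧
        AdmitsNondiscreteHausdorffRingTopology Δ := by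
  refine ⟨?_, fun hno => ?_⟩
  · rintro hmin ⟨n, Δ, _, hn, hsummand, hΔ⟩
    exact hmin.not_hasDirectSummand hlc hn hΔ hsummand
  · obtain ⟨e, he⟩ := hlc.exists_one hss
    let ring : Ring R :=
      { (inferInstance : NonUnitalRing R) with
        one := e
        one_mul := fun x => (he x).1
        mul_one := fun x => (he x).2 }
    exact hlc.isMinimalTopologicalRing hss hno
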